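/- Let $G$ be a finite simple graph admitting a perfect matching. $G$ is said to be PMH (to have the Perfect-Matching-Hamiltonian property) if for every perfect matching $M$ of $G$ there exists another perfect matching $N$ of $G$ such that $M\cup N$ is the edge set of a Hamiltonian cycle of $G$. For positive integers $r$ and $\ell$, let $s=\min\{r,\ell\}$. The papillon graph $\mathcal{P}_{r,\ell}$ is the simple graph on the $4r+4\ell$ vertices $u_1,\ldots,u_{2r+2\ell},v_1,\ldots,v_{2r+2\ell}$ whose edges are exactly: 1. the edges $u_iu_{i+1}$ for $1\le i\le 2r+2\ell-1$, and the edge $u_{2r+2\ell}u_1$; 2. the edges $u_iv_i$ for $1\le i\le 2r+2\ell$; 3. the edges $v_{2i-1}v_{2i}$ for $1\le i\le r+\ell$, the edges $v_{2i-1}v_{2i+2}$ for $1\le i\le r+\ell-1$ with $i\ne s$, and the two edges $v_2v_{2s+2}$ and $v_{2s-1}v_{2r+2\ell-1}$. Then, for all positive integers $r$ and $\ell$, the papillon graph $\mathcal{P}_{r,\ell}$ is PMH if and only if $r$ and $\ell$ are both even. -/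

import Mathlib

/-- A graph is PMH if it has a perfect matching and for every perfect matching `M` there is another
perfect matching `N` such that `M ∪ N` is the edge set of a Hamiltonian cycle. -/
def IsPMH {V : Type*} [DecidableEq V] (G : SimpleGraph V) : Prop :=
  (∃ M : G.Subgraph, M.IsPerfectMatching) ∧
    ∀ M : G.Subgraph, M.IsPerfectMatching →
      ∃ N : G.Subgraph, N.IsPerfectMatching ∧ N ≠ M ∧
        ∃ (x : V) (p : G.Walk x x), p.IsHamiltonianCycle ∧
          {e | e ∈ p.edges} = M.edgeSet ∪ N.edgeSet

/-- `Sum.inl i` is the vertex `u_{i+1}` and `Sum.inr i` is the vertex `v_{i+1}`. -/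
abbrev PapillonVertex (r l : ℕ) : Type := Fin (2 * r + 2 * l) ⊕ Fin (2 * r + 2 * l)

/-- The edges `u_a u_b` (each listed in one orientation), with `a`, `b` counted from `1`. -/
def PapillonOuter (r l a b : ℕ) : Prop :=
  b = a + 1 ∨ (a = 2 * r + 2 * l ∧ b = 1)

/-- The edges `v_a v_b` (each listed in one orientation), with `a`, `b` counted from `1`. -/
def PapillonInner (r l a b : ℕ) : Prop :=
  (∃ i, 1 ≤ i ∧ i ≤ r + l ∧ a = 2 * i - 1 ∧ b = 2 * i) ∨
  (∃ i, 1 ≤ i ∧ i ≤ r + l - 1 ∧ i ≠ min r l ∧ a = 2 * i - 1 ∧ b = 2 * i + 2) ∨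
  (a = 2 ∧ b = 2 * min r l + 2) ∨
  (a = 2 * min r l - 1 ∧ b = 2 * r + 2 * l - 1)

/-- The edges of the papillon graph, each listed in one orientation. -/
def PapillonRel (r l : ℕ) : PapillonVertex r l → PapillonVertex r l → Prop
  | Sum.inl i, Sum.inl j => PapillonOuter r l (i.val + 1) (j.val + 1)
  | Sum.inl i, Sum.inr j => i = j
  | Sum.inr _, Sum.inl _ => False
  | Sum.inr i, Sum.inr j => PapillonInner r l (i.val + 1) (j.val + 1)

/-- The papillon graph with (positive) parameters `r` and `l`. -/
def papillonGraph (r l : ℕ) : SimpleGraph (PapillonVertex r l) :=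
  SimpleGraph.fromRel (PapillonRel r l)

/-! The graph is two chains of 4-cycles (blocks), `min r l` and `max r l` long. With left side
`{u_{2i-1}, v_{2i}}` and right side `{u_{2i}, v_{2i-1}}`, a block is complete bipartite between its
sides, and all other edges, the crossing ones, preserve the level (`u` or `v`). By
`matching_trichotomy` a perfect matching is internal, mixed or the set of all crossing edges. An
internal and a mixed matching form a Hamiltonian cycle as soon as they are disjoint; an internal one
and the crossing edges do if some chain has an odd number of crosswise blocks. If both lengths are
even, every matching has such a companion: an internal one with no odd chain has evenly many
straight blocks in each chain, so a mixed level that flips exactly at these closes up. Conversely, a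
companion of the all-straight matching must be mixed and flip its level in every block; both ends of
a chain carry the same level, so each length is even. -/

namespace PapillonPMH

/-! ### Perfect matchings as involutions, Hamiltonian cycles as transitivity -/

section General

variable {V : Type*} {G : SimpleGraph V}

/-- A perfect matching presented as the involution sending a vertex to its partner. -/
def IsMatchingMap (G : SimpleGraph V) (f : V → V) : Prop :=
  Function.Involutive f ∧ ∀ v, G.Adj v (f v)

/-- Every two-colouring that is invariant under `f` and `g` is constant. -/
def JointlyTransitive (f g : V → V) : Prop :=
  ∀ c : V → Bool, (∀ v, c (f v) = c v) → (∀ v, c (g v) = c v) → ∀ v w, c v = c w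

/-- The PMH property in terms of involutions. -/
def IsPMHMap (G : SimpleGraph V) : Prop :=
  (∃ f, IsMatchingMap G f) ∧
    ∀ f, IsMatchingMap G f → ∃ g, IsMatchingMap G g ∧ (∀ v, f v ≠ g v) ∧ JointlyTransitive f g

theorem JointlyTransitive.symm {f g : V → V} (h : JointlyTransitive f g) :
    JointlyTransitive g f :=
  fun c hg hf => h c hf hg

/-- The subgraph whose edges are `v — f v`. -/
def matchingOfMap (f : V → V) (hf : IsMatchingMap G f) : G.Subgraph where
  verts := Set.univ
  Adj v w := f v = w
  adj_sub := by rintro v w rfl; exact hf.2 v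
  edge_vert _ := Set.mem_univ _
  symm := ⟨by rintro v w rfl; exact hf.1 v⟩

theorem matchingOfMap_isPerfectMatching (f : V → V) (hf : IsMatchingMap G f) :
    (matchingOfMap f hf).IsPerfectMatching := by
  rw [SimpleGraph.Subgraph.isPerfectMatching_iff]
  intro v
  exact ⟨f v, rfl, fun w hw => Eq.symm hw⟩

theorem exists_map_of_isPerfectMatching {M : G.Subgraph} (hM : M.IsPerfectMatching) :
    ∃ f, IsMatchingMap G f ∧ ∀ v w, M.Adj v w ↔ f v = w := by
  rw [SimpleGraph.Subgraph.isPerfectMatching_iff] at hM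
  choose f hf huniq using hM
  have key : ∀ v w, M.Adj v w ↔ f v = w :=
    fun v w => ⟨fun h => (huniq v w h).symm, by rintro rfl; exact hf v⟩
  exact ⟨f, ⟨fun v => (key _ _).1 (hf v).symm, fun v => (hf v).adj_sub⟩, key⟩

theorem eq_of_mem_support_of_edges {c : V → Bool} {a b : V} (p : G.Walk a b)
    (h : ∀ v w, s(v, w) ∈ p.edges → c v = c w) : ∀ v ∈ p.support, c v = c a := by
  induction p with
  | nil => simp
  | cons hadj p ih =>
    intro v hv
    rw [SimpleGraph.Walk.support_cons, List.mem_cons] at hv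
    rcases hv with rfl | hv
    · rfl
    · rw [ih (fun x y hxy => h x y (by simp [hxy])) v hv]
      exact (h _ _ (by simp)).symm

/-- The union of the two matchings is 2-regular because partners differ, and connected because the
colouring by reachability from a vertex is invariant; its only component is therefore a spanning
cycle. -/
theorem exists_hamiltonianCycle [Finite V] [DecidableEq V] [Nonempty V] {f g : V → V}
    (hf : IsMatchingMap G f) (hg : IsMatchingMap G g) (hne : ∀ v, f v ≠ g v)
    (hc : JointlyTransitive f g) :
    ∃ (x : V) (p : G.Walk x x), p.IsHamiltonianCycle ∧
      ∀ v w, s(v, w) ∈ p.edges ↔ f v = w ∨ g v = w := by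
  classical
  let H : SimpleGraph V :=
    { Adj := fun v w => f v = w ∨ g v = w
      symm := ⟨by
        rintro v w (rfl | rfl)
        · exact Or.inl (hf.1 v)
        · exact Or.inr (hg.1 v)⟩
      loopless := ⟨by
        rintro v (h | h)
        · exact (hf.2 v).ne h.symm
        · exact (hg.2 v).ne h.symm⟩ }
  have hHG : H ≤ G := by
    rintro v w (rfl | rfl)
    · exact hf.2 v
    · exact hg.2 v
  have hnbr : ∀ v, H.neighborSet v = {f v, g v} := by
    intro v; ext w
    simp [H, SimpleGraph.mem_neighborSet, eq_comm]
  have hcard : ∀ v, (H.neighborSet v).ncard = 2 := by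
    intro v; rw [hnbr]; exact Set.ncard_pair (hne v)
  have hcyc : H.IsCycles := fun v _ => hcard v
  have hreach : ∀ v w, H.Reachable v w := by
    intro v w
    have := hc (fun x => decide (H.Reachable v x))
      (fun x => by
        have hx : H.Adj x (f x) := Or.inl rfl
        simp only [decide_eq_decide]
        exact ⟨fun h => h.trans hx.symm.reachable, fun h => h.trans hx.reachable⟩)
      (fun x => by
        have hx : H.Adj x (g x) := Or.inr rfl
        simp only [decide_eq_decide]
        exact ⟨fun h => h.trans hx.symm.reachable, fun h => h.trans hx.reachable⟩) v w
    simpa using this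
  obtain ⟨x⟩ := ‹Nonempty V›
  obtain ⟨p, hp, hverts⟩ := hcyc.exists_cycle_toSubgraph_verts_eq_connectedComponentSupp
    (c := H.connectedComponentMk x) (v := x) rfl ⟨f x, Or.inl rfl⟩
  have hsupp : ∀ v, v ∈ p.support := by
    intro v
    rw [← SimpleGraph.Walk.mem_verts_toSubgraph, hverts]
    exact SimpleGraph.ConnectedComponent.sound (hreach v x)
  refine ⟨x, p.mapLe hHG, ?_, ?_⟩
  · rw [SimpleGraph.Walk.isHamiltonianCycle_iff_isCycle_and_support_count_tail_eq_one]
    refine ⟨hp.mapLe hHG, fun v => ?_⟩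
    rw [SimpleGraph.Walk.support_mapLe_eq_support]
    refine List.count_eq_one_of_mem hp.support_nodup ?_
    rw [← SimpleGraph.Walk.support_tail_of_not_nil p hp.not_nil]
    rcases eq_or_ne v x with rfl | hvx
    · exact SimpleGraph.Walk.end_mem_support _
    · have := hsupp v
      rw [← SimpleGraph.Walk.cons_tail_support, List.mem_cons] at this
      rw [SimpleGraph.Walk.support_tail_of_not_nil p hp.not_nil]
      exact this.resolve_left hvx
  · intro v w
    rw [SimpleGraph.Walk.edges_mapLe_eq_edges, ← SimpleGraph.Walk.adj_toSubgraph_iff_mem_edges]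
    -- The cycle already uses two edges at every vertex, so it contains all edges of `H`.
    have heq : p.toSubgraph.neighborSet v = H.neighborSet v :=
      Set.eq_of_subset_of_ncard_le (p.toSubgraph.neighborSet_subset v)
        (by rw [hcard, hp.ncard_neighborSet_toSubgraph_eq_two (hsupp v)]) (Set.toFinite _)
    exact Set.ext_iff.1 heq w

theorem isPMH_iff_isPMHMap [Finite V] [DecidableEq V] [Nonempty V] :
    IsPMH G ↔ IsPMHMap G := by
  constructor
  · rintro ⟨⟨M, hM⟩, h⟩
    obtain ⟨f₀, hf₀, -⟩ := exists_map_of_isPerfectMatching hM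
    refine ⟨⟨f₀, hf₀⟩, fun f hf => ?_⟩
    obtain ⟨N, hN, -, x, p, hp, hedges⟩ := h _ (matchingOfMap_isPerfectMatching f hf)
    obtain ⟨g, hg, hNg⟩ := exists_map_of_isPerfectMatching hN
    have hmem : ∀ v w, s(v, w) ∈ p.edges ↔ f v = w ∨ g v = w := by
      intro v w
      have := Set.ext_iff.1 hedges s(v, w)
      rw [Set.mem_union, SimpleGraph.Subgraph.mem_edgeSet, SimpleGraph.Subgraph.mem_edgeSet,
        hNg] at this
      exact this
    refine ⟨g, hg, fun v hv => ?_, fun c hcf hcg v w => ?_⟩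
    · have h2 := hp.isCycle.ncard_neighborSet_toSubgraph_eq_two (hp.mem_support v)
      have h1 : p.toSubgraph.neighborSet v = {f v} := by
        ext w
        rw [SimpleGraph.Subgraph.mem_neighborSet,
          SimpleGraph.Walk.adj_toSubgraph_iff_mem_edges, hmem, ← hv]
        simp [eq_comm]
      rw [h1, Set.ncard_singleton] at h2
      omega
    · have key := eq_of_mem_support_of_edges (c := c) p (by
        intro v w hvw
        rcases (hmem v w).1 hvw with rfl | rfl
        · exact (hcf v).symm
        · exact (hcg v).symm)
      rw [key v (hp.mem_support v), key w (hp.mem_support w)]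
  · rintro ⟨⟨f₀, hf₀⟩, h⟩
    refine ⟨⟨_, matchingOfMap_isPerfectMatching f₀ hf₀⟩, fun M hM => ?_⟩
    obtain ⟨f, hf, hMf⟩ := exists_map_of_isPerfectMatching hM
    obtain ⟨g, hg, hne, hc⟩ := h f hf
    obtain ⟨x, p, hp, hedges⟩ := exists_hamiltonianCycle hf hg hne hc
    refine ⟨matchingOfMap g hg, matchingOfMap_isPerfectMatching g hg, ?_, x, p, hp, ?_⟩
    · rintro rfl
      exact hne x ((hMf x (g x)).1 rfl)
    · ext e
      induction e with
      | _ v w =>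
        rw [Set.mem_union, SimpleGraph.Subgraph.mem_edgeSet, SimpleGraph.Subgraph.mem_edgeSet, hMf]
        exact hedges v w

theorem IsMatchingMap.conj {W : Type*} {H : SimpleGraph W} (e : G ≃g H) {f : W → W}
    (hf : IsMatchingMap H f) : IsMatchingMap G (fun v => e.symm (f (e v))) := by
  refine ⟨fun v => by simp [hf.1 (e v)], fun v => ?_⟩
  rw [← e.map_adj_iff]
  simpa using hf.2 (e v)

theorem IsPMHMap.of_iso {W : Type*} {H : SimpleGraph W} (e : G ≃g H) (h : IsPMHMap H) :
    IsPMHMap G := by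
  obtain ⟨⟨f₀, hf₀⟩, h⟩ := h
  refine ⟨⟨_, hf₀.conj e⟩, fun f hf => ?_⟩
  obtain ⟨g, hg, hne, hc⟩ := h _ (hf.conj e.symm)
  refine ⟨_, hg.conj e, fun v hv => hne (e v) ?_, fun c hcf hcg v w => ?_⟩
  · simp [hv]
  · have := hc (fun x => c (e.symm x)) (fun x => by simp [hcf])
      (fun x => by simpa using hcg (e.symm x)) (e v) (e w)
    simpa using this

theorem isPMHMap_congr {W : Type*} {H : SimpleGraph W} (e : G ≃g H) :
    IsPMHMap G ↔ IsPMHMap H :=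
  ⟨IsPMHMap.of_iso e.symm, IsPMHMap.of_iso e⟩

end General

/-! ### Two chains of four-cycles -/

section Chains

variable {n : Bool → ℕ}

/-- Vertices of two chains of four-cycles: the chain, the block in it, the side of the block
(`false` is left) and the level (`true` is the outer cycle). -/
abbrev ChainVertex (n : Bool → ℕ) : Type := Σ κ : Bool, Fin (n κ + 1) × Bool × Bool

/-- The vertex of level `p` at the left (`a = false`) or right end of the chain `κ`. -/
def chainEnd (n : Bool → ℕ) (κ a p : Bool) : ChainVertex n :=
  ⟨κ, if a then Fin.last _ else 0, a, p⟩

/-- The neighbour of a vertex outside of its block. -/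
def crossing : ChainVertex n → ChainVertex n
  | ⟨κ, i, false, p⟩ =>
    Fin.cases (motive := fun _ => ChainVertex n) (chainEnd n (!κ) p p)
      (fun j => ⟨κ, j.castSucc, true, p⟩) i
  | ⟨κ, i, true, p⟩ =>
    Fin.lastCases (motive := fun _ => ChainVertex n) (chainEnd n (!κ) (!p) p)
      (fun j => ⟨κ, j.succ, false, p⟩) i

@[simp] theorem crossing_left_zero (κ p : Bool) :
    crossing (⟨κ, 0, false, p⟩ : ChainVertex n) = chainEnd n (!κ) p p := rfl

@[simp] theorem crossing_left_succ (κ p : Bool) (j : Fin (n κ)) :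
    crossing (⟨κ, j.succ, false, p⟩ : ChainVertex n) = ⟨κ, j.castSucc, true, p⟩ := rfl

@[simp] theorem crossing_right_last (κ p : Bool) :
    crossing (⟨κ, Fin.last _, true, p⟩ : ChainVertex n) = chainEnd n (!κ) (!p) p := by
  simp [crossing]

@[simp] theorem crossing_right_castSucc (κ p : Bool) (j : Fin (n κ)) :
    crossing (⟨κ, j.castSucc, true, p⟩ : ChainVertex n) = ⟨κ, j.succ, false, p⟩ := by
  simp [crossing]

theorem crossing_chainEnd (κ a p : Bool) :
    crossing (chainEnd n κ a p) = chainEnd n (!κ) (a ^^ p) p := by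
  cases a <;> simp [chainEnd]

theorem crossing_involutive : Function.Involutive (crossing (n := n)) := by
  rintro ⟨κ, i, a, p⟩
  cases a
  · induction i using Fin.cases with
    | zero => rw [crossing_left_zero, crossing_chainEnd]; cases κ <;> simp [chainEnd]
    | succ j => simp
  · induction i using Fin.lastCases with
    | last => rw [crossing_right_last, crossing_chainEnd]; cases κ <;> simp [chainEnd] <;> rfl
    | cast j => simp

theorem crossing_level (v : ChainVertex n) : (crossing v).2.2.2 = v.2.2.2 := by
  obtain ⟨κ, i, a, p⟩ := v
  cases a
  · induction i using Fin.cases <;> rfl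
  · induction i using Fin.lastCases with
    | last => rw [crossing_right_last]; rfl
    | cast j => rw [crossing_right_castSucc]

theorem crossing_ne_of_same_block (κ : Bool) (i : Fin (n κ + 1)) (a p b q : Bool) :
    crossing (⟨κ, i, a, p⟩ : ChainVertex n) ≠ ⟨κ, i, b, q⟩ := by
  intro h
  cases a
  · induction i using Fin.cases with
    | zero => rw [crossing_left_zero] at h; simpa [chainEnd] using congrArg Sigma.fst h
    | succ j => simp [Fin.ext_iff] at h
  · induction i using Fin.lastCases with
    | last => rw [crossing_right_last] at h; simpa [chainEnd] using congrArg Sigma.fst h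
    | cast j => simp [Fin.ext_iff] at h

/-- Two chains of four-cycles joined by `crossing`. -/
def chainGraph (n : Bool → ℕ) : SimpleGraph (ChainVertex n) where
  Adj v w := (∃ q, w = ⟨v.1, v.2.1, !v.2.2.1, q⟩) ∨ w = crossing v
  symm := ⟨by
    rintro ⟨κ, i, a, p⟩ w (⟨q, rfl⟩ | rfl)
    · exact Or.inl ⟨p, by simp⟩
    · exact Or.inr (crossing_involutive _).symm⟩
  loopless := ⟨by
    rintro ⟨κ, i, a, p⟩ (⟨q, h⟩ | h)
    · simp at h
    · exact crossing_ne_of_same_block _ _ _ _ _ _ h.symm⟩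

theorem chainGraph_adj {v w : ChainVertex n} :
    (chainGraph n).Adj v w ↔ (∃ q, w = ⟨v.1, v.2.1, !v.2.2.1, q⟩) ∨ w = crossing v := Iff.rfl

/-- `f` matches every block within itself, straight where `x` is `false` and crosswise where `x`
is `true`. -/
def IsInternal (f : ChainVertex n → ChainVertex n) (x : ∀ κ, Fin (n κ + 1) → Bool) : Prop :=
  ∀ κ i a p, f ⟨κ, i, a, p⟩ = ⟨κ, i, !a, p ^^ x κ i⟩

/-- In every block and on each side `a`, `f` matches the vertex of level `t κ i a` along its
crossing edge and the other one within the block. -/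
def IsMixed (f : ChainVertex n → ChainVertex n) (t : ∀ κ, Fin (n κ + 1) → Bool → Bool) : Prop :=
  ∀ κ i a, f ⟨κ, i, a, t κ i a⟩ = crossing ⟨κ, i, a, t κ i a⟩ ∧
    f ⟨κ, i, a, !t κ i a⟩ = ⟨κ, i, !a, !t κ i (!a)⟩

/-- The matching map within the blocks given by `x`. -/
def internalMap (x : ∀ κ, Fin (n κ + 1) → Bool) : ChainVertex n → ChainVertex n :=
  fun v => ⟨v.1, v.2.1, !v.2.2.1, v.2.2.2 ^^ x v.1 v.2.1⟩

theorem internalMap_isInternal (x : ∀ κ, Fin (n κ + 1) → Bool) :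
    IsInternal (internalMap x) x := fun _ _ _ _ => rfl

theorem internalMap_isMatchingMap (x : ∀ κ, Fin (n κ + 1) → Bool) :
    IsMatchingMap (chainGraph n) (internalMap x) :=
  ⟨fun ⟨κ, i, a, p⟩ => by simp [internalMap], fun _ => Or.inl ⟨_, rfl⟩⟩

theorem crossing_isMatchingMap : IsMatchingMap (chainGraph n) crossing :=
  ⟨crossing_involutive, fun _ => Or.inr rfl⟩

theorem bool_cases_not (p b : Bool) : p = b ∨ p = !b := by
  cases p <;> cases b <;> simp

/-- Both ends of each chosen crossing edge must choose it. Within a chain this is `hstep`; at the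
chain ends the outer level is always chosen, and outer edges join a left end to a right end. -/
theorem exists_isMixed (t : ∀ κ, Fin (n κ + 1) → Bool → Bool)
    (hstep : ∀ κ (j : Fin (n κ)), t κ j.succ false = t κ j.castSucc true)
    (hleft : ∀ κ, t κ 0 false = true) (hright : ∀ κ, t κ (Fin.last _) true = true) :
    ∃ f, IsMatchingMap (chainGraph n) f ∧ IsMixed f t := by
  let good : ChainVertex n → Prop := fun v => v.2.2.2 = t v.1 v.2.1 v.2.2.1
  let f : ChainVertex n → ChainVertex n := fun v =>
    if v.2.2.2 = t v.1 v.2.1 v.2.2.1 then crossing v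
    else ⟨v.1, v.2.1, !v.2.2.1, !t v.1 v.2.1 (!v.2.2.1)⟩
  have h1 : ∀ κ i a, f ⟨κ, i, a, t κ i a⟩ = crossing ⟨κ, i, a, t κ i a⟩ :=
    fun κ i a => if_pos rfl
  have h2 : ∀ κ i a, f ⟨κ, i, a, !t κ i a⟩ = ⟨κ, i, !a, !t κ i (!a)⟩ :=
    fun κ i a => if_neg (by simp)
  refine ⟨f, ⟨?_, ?_⟩, fun κ i a => ⟨h1 κ i a, h2 κ i a⟩⟩
  · rintro ⟨κ, i, a, p⟩
    rcases bool_cases_not p (t κ i a) with rfl | rfl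
    · rw [h1]
      have hc : good (crossing ⟨κ, i, a, t κ i a⟩) := by
        cases a
        · induction i using Fin.cases with
          | zero => rw [crossing_left_zero, hleft]; exact (hright _).symm
          | succ j => rw [crossing_left_succ]; exact hstep κ j
        · induction i using Fin.lastCases with
          | last => rw [crossing_right_last, hright]; exact (hleft _).symm
          | cast j => rw [crossing_right_castSucc]; exact (hstep κ j).symm
      exact (if_pos hc).trans (crossing_involutive _)
    · rw [h2, h2, Bool.not_not]
  · rintro ⟨κ, i, a, p⟩
    rcases bool_cases_not p (t κ i a) with rfl | rfl
    · rw [h1]; exact Or.inr rfl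
    · rw [h2]; exact Or.inl ⟨_, rfl⟩

/-! ### Classification of the perfect matchings -/

/-- The level of the partner of a vertex matched within its block. -/
def partner (f : ChainVertex n → ChainVertex n) (κ : Bool) (i : Fin (n κ + 1)) (a p : Bool) :
    Option Bool :=
  if f ⟨κ, i, a, p⟩ = crossing ⟨κ, i, a, p⟩ then none else some (f ⟨κ, i, a, p⟩).2.2.2

variable {f g : ChainVertex n → ChainVertex n}

theorem partner_eq_none_iff {κ : Bool} {i : Fin (n κ + 1)} {a p : Bool} :
    partner f κ i a p = none ↔ f ⟨κ, i, a, p⟩ = crossing ⟨κ, i, a, p⟩ := by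
  unfold partner; split_ifs with h <;> simp [h]

theorem partner_eq_some_iff (hf : IsMatchingMap (chainGraph n) f) {κ : Bool} {i : Fin (n κ + 1)}
    {a p q : Bool} : partner f κ i a p = some q ↔ f ⟨κ, i, a, p⟩ = ⟨κ, i, !a, q⟩ := by
  unfold partner
  split_ifs with h
  · simp [h, crossing_ne_of_same_block]
  · obtain ⟨q', hq'⟩ := (chainGraph_adj.1 (hf.2 ⟨κ, i, a, p⟩)).resolve_right h
    rw [hq']
    simp

theorem partner_symm (hf : IsMatchingMap (chainGraph n) f) {κ : Bool} {i : Fin (n κ + 1)}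
    {a p q : Bool} (h : partner f κ i a p = some q) : partner f κ i (!a) q = some p := by
  rw [partner_eq_some_iff hf] at h ⊢
  rw [← h, hf.1, Bool.not_not]

theorem crossing_matched_iff (hf : IsMatchingMap (chainGraph n) f) (v : ChainVertex n) :
    f (crossing v) = crossing (crossing v) ↔ f v = crossing v := by
  rw [crossing_involutive v]
  exact ⟨fun h => by rw [← hf.1 (crossing v), h], fun h => by rw [← h, hf.1]⟩

theorem block_trichotomy : ∀ h : Bool → Bool → Option Bool,
    (∀ a p q, h a p = some q → h (!a) q = some p) →
    (∃ x, ∀ a p, h a p = some (p ^^ x)) ∨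
    (∃ t : Bool → Bool, ∀ a, h a (t a) = none ∧ h a (!t a) = some (!t (!a))) ∨
    ∀ a p, h a p = none := by
  decide

/-- The number of vertices on the side `a` of a block that are matched along crossing edges. -/
def crossCount (f : ChainVertex n → ChainVertex n) (κ : Bool) (i : Fin (n κ + 1)) (a : Bool) : ℕ :=
  (partner f κ i a false).isNone.toNat + (partner f κ i a true).isNone.toNat

/-- Edges within a block pair left vertices with right ones, so equally many remain on each side. -/
theorem crossCount_left_eq_right (hf : IsMatchingMap (chainGraph n) f) (κ : Bool)
    (i : Fin (n κ + 1)) : crossCount f κ i false = crossCount f κ i true := by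
  have key : ∀ h : Bool → Bool → Option Bool,
      (∀ a p q, h a p = some q → h (!a) q = some p) →
      (h false false).isNone.toNat + (h false true).isNone.toNat =
        (h true false).isNone.toNat + (h true true).isNone.toNat := by
    decide
  exact key (partner f κ i) fun a p q => partner_symm hf

theorem isNone_partner_succ (hf : IsMatchingMap (chainGraph n) f) (κ : Bool) (j : Fin (n κ))
    (p : Bool) :
    (partner f κ j.succ false p).isNone = (partner f κ j.castSucc true p).isNone := by
  rw [Bool.eq_iff_iff, Option.isNone_iff_eq_none, Option.isNone_iff_eq_none, partner_eq_none_iff,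
    partner_eq_none_iff, ← crossing_matched_iff hf ⟨κ, j.castSucc, true, p⟩,
    crossing_right_castSucc]

theorem crossCount_eq_zero_left (hf : IsMatchingMap (chainGraph n) f) (κ : Bool)
    (i : Fin (n κ + 1)) (a : Bool) : crossCount f κ i a = crossCount f κ 0 false := by
  have hleft : crossCount f κ i false = crossCount f κ 0 false := by
    induction i using Fin.induction with
    | zero => rfl
    | succ j ih =>
      rw [← ih, crossCount_left_eq_right hf κ j.castSucc]
      simp only [crossCount, isNone_partner_succ hf]
  cases a
  · exact hleft
  · rw [← crossCount_left_eq_right hf, hleft]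

/-- Whether the vertex of level `p` at an end of a chain is matched along its crossing edge. -/
def endCross (f : ChainVertex n → ChainVertex n) (κ a p : Bool) : Bool :=
  (partner f κ (if a then Fin.last _ else 0) a p).isNone

theorem endCross_eq (hf : IsMatchingMap (chainGraph n) f) (κ a p : Bool) :
    endCross f κ a p = endCross f (!κ) (a ^^ p) p := by
  rw [endCross, endCross, Bool.eq_iff_iff, Option.isNone_iff_eq_none, Option.isNone_iff_eq_none,
    partner_eq_none_iff, partner_eq_none_iff]
  change f (chainEnd n κ a p) = crossing (chainEnd n κ a p) ↔
    f (chainEnd n (!κ) (a ^^ p) p) = crossing (chainEnd n (!κ) (a ^^ p) p)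
  rw [← crossing_chainEnd]
  exact (crossing_matched_iff hf _).symm

theorem crossCount_end (hf : IsMatchingMap (chainGraph n) f) (κ a : Bool) :
    (endCross f κ a false).toNat + (endCross f κ a true).toNat = crossCount f κ 0 false := by
  rw [← crossCount_eq_zero_left hf κ (if a then Fin.last _ else 0) a]
  rfl

theorem crossCount_const (hf : IsMatchingMap (chainGraph n) f) (κ : Bool) (i : Fin (n κ + 1))
    (a : Bool) : crossCount f κ i a = crossCount f false 0 false := by
  rw [crossCount_eq_zero_left hf]
  cases κ
  · rfl
  -- The four edges joining the chains are counted once from each chain: the two end counts of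
  -- either chain have the same sum.
  · have h1 := crossCount_end hf false false
    have h2 := crossCount_end hf false true
    have h3 := crossCount_end hf true false
    have h4 := crossCount_end hf true true
    have e1 := endCross_eq hf false false false
    have e2 := endCross_eq hf false false true
    have e3 := endCross_eq hf false true false
    have e4 := endCross_eq hf false true true
    simp only [Bool.not_false, Bool.xor_false, Bool.xor_true, Bool.not_true] at e1 e2 e3 e4
    rw [← e1, ← e4] at h3
    rw [← e2, ← e3] at h4
    omega

theorem IsMixed.level_unique {t : ∀ κ, Fin (n κ + 1) → Bool → Bool} (ht : IsMixed f t)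
    {κ : Bool} {i : Fin (n κ + 1)} {a p : Bool}
    (h : f ⟨κ, i, a, p⟩ = crossing ⟨κ, i, a, p⟩) : t κ i a = p := by
  rcases bool_cases_not p (t κ i a) with hp | rfl
  · exact hp.symm
  · rw [(ht κ i a).2] at h
    exact absurd h.symm (crossing_ne_of_same_block _ _ _ _ _ _)

theorem IsMixed.step (hf : IsMatchingMap (chainGraph n) f)
    {t : ∀ κ, Fin (n κ + 1) → Bool → Bool} (ht : IsMixed f t) (κ : Bool) (j : Fin (n κ)) :
    t κ j.succ false = t κ j.castSucc true := by
  apply ht.level_unique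
  rw [← crossing_right_castSucc, crossing_matched_iff hf]
  exact (ht _ _ _).1

/-- An outer edge at one end and an inner edge at the other would arrive at the same end of the
other chain, which has only one crossing level. -/
theorem IsMixed.ends (hf : IsMatchingMap (chainGraph n) f)
    {t : ∀ κ, Fin (n κ + 1) → Bool → Bool} (ht : IsMixed f t) (κ : Bool) :
    t κ 0 false = t κ (Fin.last _) true := by
  have key : ∀ a p, t κ (if a then Fin.last _ else 0) a = p →
      t (!κ) (if (a ^^ p) then Fin.last _ else 0) (a ^^ p) = p := by
    rintro a p hp
    apply ht.level_unique
    change f (chainEnd n (!κ) (a ^^ p) p) = crossing (chainEnd n (!κ) (a ^^ p) p)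
    rw [← crossing_chainEnd, crossing_matched_iff hf]
    have := (ht κ (if a then Fin.last _ else 0) a).1
    rw [hp] at this
    exact this
  have k1 := key false _ rfl
  have k2 := key true _ rfl
  simp only [Bool.false_eq_true, if_false, if_true] at k1 k2
  cases h1 : t κ 0 false <;> cases h2 : t κ (Fin.last _) true <;>
    simp_all

/-- A perfect matching lies inside the blocks, or has one crossing edge between any two
consecutive blocks, or consists of all crossing edges. -/
theorem matching_trichotomy (hf : IsMatchingMap (chainGraph n) f) :
    (∃ x, IsInternal f x) ∨ (∃ t, IsMixed f t) ∨ f = crossing := by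
  -- The three block types have crossing counts 0, 1 and 2; as the count is constant, all blocks
  -- share one type.
  have tri : ∀ κ i, _ := fun κ i => block_trichotomy (partner f κ i) fun a p q => partner_symm hf
  have c0 : ∀ κ i, (∃ x, ∀ a p, partner f κ i a p = some (p ^^ x)) →
      crossCount f κ i false = 0 := by
    rintro κ i ⟨x, hx⟩
    simp [crossCount, hx]
  have c1 : ∀ κ i, (∃ t : Bool → Bool, ∀ a, partner f κ i a (t a) = none ∧
      partner f κ i a (!t a) = some (!t (!a))) → crossCount f κ i false = 1 := by
    rintro κ i ⟨t, ht⟩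
    have := ht false
    cases h : t false <;> simp_all [crossCount]
  have c2 : ∀ κ i, (∀ a p, partner f κ i a p = none) → crossCount f κ i false = 2 := by
    rintro κ i h
    simp [crossCount, h]
  have hc := fun κ i => crossCount_const hf κ i false
  have h3 : crossCount f false 0 false = 0 ∨ crossCount f false 0 false = 1 ∨
      crossCount f false 0 false = 2 := by
    rcases tri false 0 with h | h | h
    · exact Or.inl (c0 _ _ h)
    · exact Or.inr (Or.inl (c1 _ _ h))
    · exact Or.inr (Or.inr (c2 _ _ h))
  rcases h3 with h3 | h3 | h3 <;> simp only [h3] at hc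
  · left
    have : ∀ κ i, ∃ x, ∀ a p, partner f κ i a p = some (p ^^ x) := by
      intro κ i
      rcases tri κ i with h | h | h
      · exact h
      · have := c1 _ _ h; have := hc κ i; omega
      · have := c2 _ _ h; have := hc κ i; omega
    choose x hx using this
    exact ⟨x, fun κ i a p => (partner_eq_some_iff hf).1 (hx κ i a p)⟩
  · right; left
    have : ∀ κ i, ∃ t : Bool → Bool, ∀ a, partner f κ i a (t a) = none ∧
        partner f κ i a (!t a) = some (!t (!a)) := by
      intro κ i
      rcases tri κ i with h | h | h
      · have := c0 _ _ h; have := hc κ i; omega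
      · exact h
      · have := c2 _ _ h; have := hc κ i; omega
    choose t ht using this
    exact ⟨t, fun κ i a => ⟨partner_eq_none_iff.1 (ht κ i a).1,
      (partner_eq_some_iff hf).1 (ht κ i a).2⟩⟩
  · right; right
    funext ⟨κ, i, a, p⟩
    rcases tri κ i with h | h | h
    · have := c0 _ _ h; have := hc κ i; omega
    · have := c1 _ _ h; have := hc κ i; omega
    · exact partner_eq_none_iff.1 (h a p)

end Chains

/-! ### Companions of a matching and the parity condition -/

section ChainsPMH

variable {n : Bool → ℕ} {f g : ChainVertex n → ChainVertex n}

theorem ne_of_isInternal_isMixed {x : ∀ κ, Fin (n κ + 1) → Bool}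
    {t : ∀ κ, Fin (n κ + 1) → Bool → Bool} (hf : IsInternal f x) (hg : IsMixed g t)
    (hxt : ∀ κ i, t κ i true = (t κ i false ^^ !x κ i)) (v : ChainVertex n) : f v ≠ g v := by
  obtain ⟨κ, i, a, p⟩ := v
  rcases bool_cases_not p (t κ i a) with rfl | rfl
  · rw [hf, (hg κ i a).1]
    exact (crossing_ne_of_same_block _ _ _ _ _ _).symm
  · rw [hf, (hg κ i a).2]
    have := hxt κ i
    cases a <;> cases h1 : t κ i false <;> cases h2 : x κ i <;> simp_all

/-- In each block the two internal edges and the single mixed one form a path through all four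
vertices; the crossing edges link these paths. -/
theorem jointlyTransitive_of_isInternal_isMixed {x : ∀ κ, Fin (n κ + 1) → Bool}
    {t : ∀ κ, Fin (n κ + 1) → Bool → Bool} (hf : IsInternal f x) (hg : IsMixed g t)
    (hxt : ∀ κ i, t κ i true = (t κ i false ^^ !x κ i)) : JointlyTransitive f g := by
  intro c hcf hcg
  have hblock : ∀ κ i a p, c ⟨κ, i, a, p⟩ = c ⟨κ, i, false, false⟩ := by
    intro κ i a p
    have e1 := hcf ⟨κ, i, false, false⟩
    have e2 := hcf ⟨κ, i, false, true⟩
    have e3 := hcg ⟨κ, i, false, !t κ i false⟩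
    rw [hf] at e1 e2
    rw [(hg κ i false).2] at e3
    have e4 := hxt κ i
    cases h1 : t κ i false <;> cases h2 : x κ i <;> cases a <;> cases p <;> simp_all
  have hstep : ∀ κ i a, c (crossing ⟨κ, i, a, t κ i a⟩) = c ⟨κ, i, false, false⟩ := by
    intro κ i a
    rw [← (hg κ i a).1, hcg, hblock]
  have hchain : ∀ κ i, c ⟨κ, i, false, false⟩ = c ⟨κ, 0, false, false⟩ := by
    intro κ i
    induction i using Fin.induction with
    | zero => rfl
    | succ j ih =>
      have h := hstep κ j.castSucc true
      rw [crossing_right_castSucc, hblock] at h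
      rw [h, ih]
  have hall : ∀ v, c v = c ⟨false, 0, false, false⟩ := by
    rintro ⟨κ, i, a, p⟩
    rw [hblock, hchain]
    cases κ
    · rfl
    · have h := hstep true 0 false
      rw [crossing_left_zero, chainEnd, hblock, hchain] at h
      exact h.symm
  intro v w
  rw [hall v, hall w]

/-- The sum modulo two of the first `k` values of `x`. -/
def prefixXor (x : ℕ → Bool) : ℕ → Bool
  | 0 => false
  | k + 1 => prefixXor x k ^^ x k

theorem prefixXor_not (x : ℕ → Bool) (k : ℕ) :
    prefixXor (fun i => !x i) k = (prefixXor x k ^^ decide (k % 2 = 1)) := by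
  induction k with
  | zero => rfl
  | succ k ih =>
    simp only [prefixXor, ih]
    rcases Nat.mod_two_eq_zero_or_one k with h | h <;>
      simp [h, Nat.add_mod]

/-- `x` extended by `false` beyond its range. -/
def extendFin {m : ℕ} (x : Fin (m + 1) → Bool) (k : ℕ) : Bool :=
  if h : k < m + 1 then x ⟨k, h⟩ else false

theorem extendFin_val {m : ℕ} (x : Fin (m + 1) → Bool) (i : Fin (m + 1)) :
    extendFin x i.val = x i :=
  dif_pos i.isLt

theorem ne_of_isInternal_crossing {x : ∀ κ, Fin (n κ + 1) → Bool} (hf : IsInternal f x)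
    (v : ChainVertex n) : f v ≠ crossing v := by
  obtain ⟨κ, i, a, p⟩ := v
  rw [hf]
  exact (crossing_ne_of_same_block _ _ _ _ _ _).symm

/-- Each chain becomes two strands, which exchange levels between its ends exactly when its number
of crosswise blocks is odd. One exchange suffices to merge the strands into one cycle. -/
theorem jointlyTransitive_of_isInternal_crossing {x : ∀ κ, Fin (n κ + 1) → Bool}
    (hf : IsInternal f x) {κ₀ : Bool} (hodd : prefixXor (extendFin (x κ₀)) (n κ₀ + 1) = true) :
    JointlyTransitive f crossing := by
  intro c hcf hcg
  have hblock : ∀ κ i p, c ⟨κ, i, true, p⟩ = c ⟨κ, i, false, p ^^ x κ i⟩ := by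
    intro κ i p
    rw [← hcf ⟨κ, i, true, p⟩, hf]; rfl
  have hleft : ∀ κ i p, c ⟨κ, i, false, p⟩ =
      c ⟨κ, 0, false, p ^^ prefixXor (extendFin (x κ)) i.val⟩ := by
    intro κ i
    induction i using Fin.induction with
    | zero => intro p; simp [prefixXor]
    | succ j ih =>
      intro p
      have h := hcg ⟨κ, j.succ, false, p⟩
      rw [crossing_left_succ, hblock, ih] at h
      rw [← h, Fin.val_succ, prefixXor, ← extendFin_val (x κ) j.castSucc, Fin.val_castSucc]
      congr 4
      cases p <;> cases extendFin (x κ) j.val <;> simp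
  have hright : ∀ κ p, c ⟨κ, Fin.last _, true, p⟩ =
      c ⟨κ, 0, false, p ^^ prefixXor (extendFin (x κ)) (n κ + 1)⟩ := by
    intro κ p
    rw [hblock, hleft, prefixXor, ← extendFin_val (x κ) (Fin.last _), Fin.val_last]
    congr 4
    cases p <;> cases extendFin (x κ) (n κ) <;> simp
  have hends : ∀ κ p, c ⟨κ, 0, false, p⟩ = c ⟨false, 0, false, false⟩ := by
    have e1 := hcg ⟨false, 0, false, false⟩
    have e2 := hcg ⟨false, 0, false, true⟩
    have e3 := hcg ⟨false, Fin.last _, true, false⟩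
    have e4 := hcg ⟨false, Fin.last _, true, true⟩
    rw [crossing_left_zero, chainEnd] at e1 e2
    rw [crossing_right_last, chainEnd] at e3 e4
    simp only [Bool.not_false, Bool.not_true, if_true, Bool.false_eq_true, if_false, hright]
      at e1 e2 e3 e4
    intro κ p
    cases hA : prefixXor (extendFin (x false)) (n false + 1) <;>
      cases hB : prefixXor (extendFin (x true)) (n true + 1) <;>
      simp only [hA, Bool.xor_false, Bool.xor_true, Bool.not_false, Bool.not_true]
        at e1 e2 e3 e4 <;>
      cases κ₀ <;> cases κ <;> cases p <;> grind
  have hall : ∀ v, c v = c ⟨false, 0, false, false⟩ := by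
    rintro ⟨κ, i, a, p⟩
    cases a
    · rw [hleft, hends]
    · rw [hblock, hleft, hends]
  intro v w
  rw [hall v, hall w]

theorem exists_partner_matching (heven : ∀ κ, Even (n κ + 1))
    (hf : IsMatchingMap (chainGraph n) f) :
    ∃ g, IsMatchingMap (chainGraph n) g ∧ (∀ v, f v ≠ g v) ∧ JointlyTransitive f g := by
  rcases matching_trichotomy hf with ⟨x, hx⟩ | ⟨t, ht⟩ | rfl
  · by_cases hodd : ∃ κ, prefixXor (extendFin (x κ)) (n κ + 1) = true
    · obtain ⟨κ, hκ⟩ := hodd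
      exact ⟨crossing, crossing_isMatchingMap, ne_of_isInternal_crossing hx,
        jointlyTransitive_of_isInternal_crossing hx hκ⟩
    · push Not at hodd
      -- The level starts outer and flips at each straight block. Crosswise blocks and all blocks
      -- are even in number, hence so are straight ones, and the level ends outer.
      let t : ∀ κ, Fin (n κ + 1) → Bool → Bool := fun κ i a =>
        !prefixXor (fun k => !extendFin (x κ) k) (i.val + a.toNat)
      obtain ⟨g, hg, hgt⟩ := exists_isMixed t (fun κ j => by simp [t])
        (fun κ => by simp [t, prefixXor]) (fun κ => by
          have h := prefixXor_not (extendFin (x κ)) (n κ + 1)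
          rw [Nat.even_iff.1 (heven κ)] at h
          simpa [t, hodd κ] using h)
      have hxt : ∀ κ i, t κ i true = (t κ i false ^^ !x κ i) := by
        intro κ i
        simp only [t, Bool.toNat_true, Bool.toNat_false, Nat.add_zero, prefixXor, extendFin_val]
        simp
      exact ⟨g, hg, ne_of_isInternal_isMixed hx hgt hxt,
        jointlyTransitive_of_isInternal_isMixed hx hgt hxt⟩
  · let x : ∀ κ, Fin (n κ + 1) → Bool := fun κ i => !(t κ i true ^^ t κ i false)
    have hx := internalMap_isInternal x
    have hxt : ∀ κ i, t κ i true = (t κ i false ^^ !x κ i) := by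
      intro κ i
      simp only [x]
      cases t κ i true <;> cases t κ i false <;> rfl
    exact ⟨_, internalMap_isMatchingMap x, fun v => (ne_of_isInternal_isMixed hx ht hxt v).symm,
      (jointlyTransitive_of_isInternal_isMixed hx ht hxt).symm⟩
  -- Only the first block of each chain is crosswise, an odd number.
  · let x : ∀ κ, Fin (n κ + 1) → Bool := fun κ i => decide (i.val = 0)
    have hx := internalMap_isInternal x
    have hodd : ∀ k, prefixXor (extendFin (x false)) (k + 1) = true := by
      intro k
      induction k with
      | zero => simp [prefixXor, extendFin, x]
      | succ k ih => rw [prefixXor, ih]; simp [extendFin, x]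
    exact ⟨_, internalMap_isMatchingMap x, fun v => (ne_of_isInternal_crossing hx v).symm,
      (jointlyTransitive_of_isInternal_crossing hx (hodd _)).symm⟩

theorem even_of_exists_partner_matching
    (h : ∃ g, IsMatchingMap (chainGraph n) g ∧
      (∀ v, internalMap (fun _ _ => false) v ≠ g v) ∧
      JointlyTransitive (internalMap fun _ _ => false) g) (κ : Bool) : Even (n κ + 1) := by
  obtain ⟨g, hg, hne, hc⟩ := h
  rcases matching_trichotomy hg with ⟨x, hx⟩ | ⟨t, ht⟩ | rfl
  -- Two internal matchings never leave a chain.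
  · have := hc (fun v => v.1) (fun _ => rfl) (fun ⟨κ, i, a, p⟩ => by simp [hx κ i a p])
      ⟨false, 0, false, false⟩ ⟨true, 0, false, false⟩
    simp at this
  · have hflip : ∀ i, t κ i true = !t κ i false := by
      intro i
      have h := hne ⟨κ, i, false, !t κ i false⟩
      rw [(ht κ i false).2] at h
      cases h1 : t κ i true <;> cases h2 : t κ i false <;> simp_all [internalMap]
    have hleft : ∀ i : Fin (n κ + 1), t κ i false = (t κ 0 false ^^ decide (i.val % 2 = 1)) := by
      intro i
      induction i using Fin.induction with
      | zero => simp
      | succ j ih =>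
        rw [ht.step hg, hflip, ih]
        rcases Nat.mod_two_eq_zero_or_one j.val with h | h <;> simp [h, Nat.add_mod]
    have hend := ht.ends hg κ
    rw [hflip, hleft (Fin.last _), Fin.val_last] at hend
    rw [Nat.even_add_one, Nat.not_even_iff]
    by_contra hpar
    simp [hpar] at hend
  -- Straight blocks and crossing edges both preserve the level.
  · have := hc (fun v => v.2.2.2) (fun ⟨κ, i, a, p⟩ => by simp [internalMap]) crossing_level
      ⟨false, 0, false, false⟩ ⟨false, 0, false, true⟩
    simp at this

theorem chainGraph_isPMHMap_iff : IsPMHMap (chainGraph n) ↔ ∀ κ, Even (n κ + 1) :=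
  ⟨fun h => even_of_exists_partner_matching (h.2 _ (internalMap_isMatchingMap _)),
    fun h => ⟨⟨crossing, crossing_isMatchingMap⟩, fun _ hf => exists_partner_matching h hf⟩⟩

end ChainsPMH

/-! ### The papillon graph as two chains -/

section Isomorphism

theorem chainVertex_mk_eq_iff {n : Bool → ℕ} {κ κ' a b p q : Bool} {i : Fin (n κ + 1)}
    {j : Fin (n κ' + 1)} :
    (⟨κ, i, a, p⟩ : ChainVertex n) = ⟨κ', j, b, q⟩ ↔
      κ = κ' ∧ i.val = j.val ∧ a = b ∧ p = q := by
  constructor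
  · intro h
    cases h
    exact ⟨rfl, rfl, rfl, rfl⟩
  · rintro ⟨rfl, hij, rfl, rfl⟩
    rw [Fin.ext hij]

theorem eq_crossing_iff {n : Bool → ℕ} {κ κ' a b p q : Bool} {i : Fin (n κ + 1)}
    {j : Fin (n κ' + 1)} :
    (⟨κ', j, b, q⟩ : ChainVertex n) = crossing ⟨κ, i, a, p⟩ ↔ q = p ∧
      ((κ' = κ ∧ b = !a ∧ (if a then j.val = i.val + 1 else i.val = j.val + 1)) ∨
        (κ' = !κ ∧ i.val = (if a then n κ else 0) ∧ b = (a ^^ p) ∧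
          j.val = if b then n κ' else 0)) := by
  have hj := j.isLt
  cases a
  · induction i using Fin.cases with
    | zero =>
      rw [crossing_left_zero, chainEnd, chainVertex_mk_eq_iff]
      cases κ <;> cases κ' <;> cases p <;> cases b <;> cases q <;> simp
    | succ i =>
      rw [crossing_left_succ, chainVertex_mk_eq_iff]
      cases κ <;> cases κ' <;> cases p <;> cases b <;> cases q <;> simp <;> omega
  · induction i using Fin.lastCases with
    | last =>
      rw [crossing_right_last, chainEnd, chainVertex_mk_eq_iff]
      cases κ <;> cases κ' <;> cases p <;> cases b <;> cases q <;> simp <;> omega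
    | cast i =>
      have hi := i.isLt
      rw [crossing_right_castSucc, chainVertex_mk_eq_iff]
      cases κ <;> cases κ' <;> cases p <;> cases b <;> cases q <;> simp <;> omega

theorem chainGraph_adj_iff {n : Bool → ℕ} {κ κ' a b p q : Bool} {i : Fin (n κ + 1)}
    {j : Fin (n κ' + 1)} :
    (chainGraph n).Adj ⟨κ, i, a, p⟩ ⟨κ', j, b, q⟩ ↔
      (κ' = κ ∧ j.val = i.val ∧ b = !a) ∨ (q = p ∧
      ((κ' = κ ∧ b = !a ∧ (if a then j.val = i.val + 1 else i.val = j.val + 1)) ∨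
        (κ' = !κ ∧ i.val = (if a then n κ else 0) ∧ b = (a ^^ p) ∧
          j.val = if b then n κ' else 0))) := by
  rw [chainGraph_adj, eq_crossing_iff]
  refine or_congr_left ⟨?_, ?_⟩
  · rintro ⟨q', h⟩
    cases h
    exact ⟨rfl, rfl, rfl⟩
  · rintro ⟨rfl, hij, rfl⟩
    exact ⟨q, by rw [Fin.ext hij]⟩

/-- Parity conditions replace the existentials, leaving linear arithmetic for `omega`. -/
theorem papillonInner_iff {r l a b : ℕ} :
    PapillonInner r l a b ↔
      (a % 2 = 1 ∧ a < 2 * (r + l) ∧ b = a + 1) ∨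
      (a % 2 = 1 ∧ a + 2 < 2 * (r + l) ∧ a + 1 ≠ 2 * min r l ∧ b = a + 3) ∨
      (a = 2 ∧ b = 2 * min r l + 2) ∨
      (a = 2 * min r l - 1 ∧ b = 2 * r + 2 * l - 1) := by
  unfold PapillonInner
  refine or_congr ⟨?_, ?_⟩ (or_congr_left ⟨?_, ?_⟩)
  · rintro ⟨i, h⟩; omega
  · rintro h; exact ⟨(a + 1) / 2, by omega⟩
  · rintro ⟨i, h⟩; omega
  · rintro h; exact ⟨(a + 1) / 2, by omega⟩

/-- The numbers of blocks, minus one, of the two chains of a papillon graph. -/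
def chainSize (r l : ℕ) (κ : Bool) : ℕ := (if κ then max r l else min r l) - 1

/-- The position from the left, in the whole graph, of a block. -/
def blockPosition (r l : ℕ) (κ : Bool) (i : ℕ) : ℕ := i + if κ then min r l else 0

theorem blockPosition_lt {r l : ℕ} (hr : 0 < r) (hl : 0 < l) {κ : Bool}
    (i : Fin (chainSize r l κ + 1)) : blockPosition r l κ i.val < r + l := by
  have := i.isLt
  cases κ <;> simp only [chainSize, blockPosition, Bool.false_eq_true, if_false, if_true] at * <;>
    omega

/-- The vertex of the papillon graph with given chain coordinates. -/
def toPapillon {r l : ℕ} (hr : 0 < r) (hl : 0 < l) :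
    ChainVertex (chainSize r l) → PapillonVertex r l
  | ⟨κ, i, a, true⟩ => Sum.inl ⟨2 * blockPosition r l κ i.val + a.toNat, by
      have := blockPosition_lt hr hl i; have := a.toNat_le; omega⟩
  -- The negation puts `v_{2i}` on the left, so that spokes run between opposite sides.
  | ⟨κ, i, a, false⟩ => Sum.inr ⟨2 * blockPosition r l κ i.val + (!a).toNat, by
      have := blockPosition_lt hr hl i; have := (!a).toNat_le; omega⟩

theorem toPapillon_bijective {r l : ℕ} (hr : 0 < r) (hl : 0 < l) :
    Function.Bijective (toPapillon hr hl) := by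
  constructor
  · rintro ⟨κ, i, a, p⟩ ⟨κ', j, b, q⟩ h
    have hi := i.isLt
    have hj := j.isLt
    rw [chainVertex_mk_eq_iff]
    cases κ <;> cases κ' <;> cases p <;> cases q <;> cases a <;> cases b <;>
      simp [toPapillon, chainSize, blockPosition] at h hi hj ⊢ <;> omega
  · have key : ∀ k : ℕ, k < r + l → ∃ κ, ∃ i : Fin (chainSize r l κ + 1),
        blockPosition r l κ i.val = k := by
      intro k hk
      by_cases h : k < min r l
      · exact ⟨false, ⟨k, by simp [chainSize]; omega⟩, by simp [blockPosition]⟩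
      · exact ⟨true, ⟨k - min r l, by simp [chainSize]; omega⟩, by simp [blockPosition]; omega⟩
    rintro (⟨k, hk⟩ | ⟨k, hk⟩) <;> obtain ⟨κ, i, hi⟩ := key (k / 2) (by omega) <;>
      rcases Nat.mod_two_eq_zero_or_one k with h | h
    · exact ⟨⟨κ, i, false, true⟩, by simp [toPapillon, hi]; omega⟩
    · exact ⟨⟨κ, i, true, true⟩, by simp [toPapillon, hi]; omega⟩
    · exact ⟨⟨κ, i, true, false⟩, by simp [toPapillon, hi]; omega⟩
    · exact ⟨⟨κ, i, false, false⟩, by simp [toPapillon, hi]; omega⟩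

theorem toPapillon_adj_outer {r l : ℕ} (hr : 0 < r) (hl : 0 < l) {κ κ' a b : Bool}
    {i : Fin (chainSize r l κ + 1)} {j : Fin (chainSize r l κ' + 1)} :
    (papillonGraph r l).Adj (toPapillon hr hl ⟨κ, i, a, true⟩) (toPapillon hr hl ⟨κ', j, b, true⟩) ↔
      (chainGraph (chainSize r l)).Adj ⟨κ, i, a, true⟩ ⟨κ', j, b, true⟩ := by
  rw [chainGraph_adj_iff, papillonGraph, SimpleGraph.fromRel_adj]
  have hi := i.isLt
  have hj := j.isLt
  have hsum := min_add_max r l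
  have hle : min r l ≤ max r l := min_le_max
  have hpos : 0 < min r l := lt_min hr hl
  cases κ <;> cases κ' <;> cases a <;> cases b <;>
    simp only [toPapillon, PapillonRel, PapillonOuter, chainSize, blockPosition, ne_eq,
      Sum.inl.injEq, Fin.mk.injEq, Bool.false_eq_true, if_false, if_true, Bool.toNat_false,
      Bool.toNat_true, Bool.not_true, Bool.not_false, Bool.xor_true, reduceCtorEq, false_and,
      and_false, true_and, and_true, or_false, false_or, iff_false]
      at hi hj ⊢ <;>
    generalize i.val = x at hi ⊢ <;> generalize j.val = y at hj ⊢ <;> clear i j <;>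
    generalize min r l = s at * <;> generalize max r l = t at * <;> omega

set_option maxHeartbeats 1000000 in
theorem toPapillon_adj_inner {r l : ℕ} (hr : 0 < r) (hl : 0 < l) {κ κ' a b : Bool}
    {i : Fin (chainSize r l κ + 1)} {j : Fin (chainSize r l κ' + 1)} :
    (papillonGraph r l).Adj (toPapillon hr hl ⟨κ, i, a, false⟩)
        (toPapillon hr hl ⟨κ', j, b, false⟩) ↔
      (chainGraph (chainSize r l)).Adj ⟨κ, i, a, false⟩ ⟨κ', j, b, false⟩ := by
  rw [chainGraph_adj_iff, papillonGraph, SimpleGraph.fromRel_adj]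
  have hi := i.isLt
  have hj := j.isLt
  have hsum := min_add_max r l
  have hle : min r l ≤ max r l := min_le_max
  have hpos : 0 < min r l := lt_min hr hl
  have hodd : ∀ m, (2 * m + 0 + 1) % 2 = 1 := by omega
  have heven : ∀ m, ¬(2 * m + 1 + 1) % 2 = 1 := by omega
  cases κ <;> cases κ' <;> cases a <;> cases b <;>
    simp only [toPapillon, PapillonRel, papillonInner_iff, hodd, heven, chainSize, blockPosition, ne_eq,
      Sum.inr.injEq, Fin.mk.injEq, Bool.false_eq_true, if_false, if_true, Bool.toNat_false,
      Bool.toNat_true, Bool.not_true, Bool.not_false, Bool.xor_false, reduceCtorEq, false_and,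
      and_false, true_and, and_true, or_false, false_or, iff_false]
      at hi hj ⊢ <;>
    generalize i.val = x at hi ⊢ <;> generalize j.val = y at hj ⊢ <;> clear i j <;>
    generalize min r l = s at * <;> generalize max r l = t at * <;> omega

theorem toPapillon_adj_spoke {r l : ℕ} (hr : 0 < r) (hl : 0 < l) {κ κ' a b : Bool}
    {i : Fin (chainSize r l κ + 1)} {j : Fin (chainSize r l κ' + 1)} :
    (papillonGraph r l).Adj (toPapillon hr hl ⟨κ, i, a, true⟩)
        (toPapillon hr hl ⟨κ', j, b, false⟩) ↔
      (chainGraph (chainSize r l)).Adj ⟨κ, i, a, true⟩ ⟨κ', j, b, false⟩ := by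
  rw [chainGraph_adj_iff, papillonGraph, SimpleGraph.fromRel_adj]
  have hi := i.isLt
  have hj := j.isLt
  cases κ <;> cases κ' <;> cases a <;> cases b <;>
    simp [toPapillon, PapillonRel, chainSize, blockPosition] at hi hj ⊢ <;> omega

theorem toPapillon_adj {r l : ℕ} (hr : 0 < r) (hl : 0 < l)
    (v w : ChainVertex (chainSize r l)) :
    (papillonGraph r l).Adj (toPapillon hr hl v) (toPapillon hr hl w) ↔
      (chainGraph (chainSize r l)).Adj v w := by
  obtain ⟨κ, i, a, p⟩ := v
  obtain ⟨κ', j, b, q⟩ := w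
  cases p <;> cases q
  · exact toPapillon_adj_inner hr hl
  · rw [SimpleGraph.adj_comm, SimpleGraph.adj_comm (chainGraph _)]
    exact toPapillon_adj_spoke hr hl
  · exact toPapillon_adj_spoke hr hl
  · exact toPapillon_adj_outer hr hl

/-- The papillon graph consists of two chains of four-cycles. -/
noncomputable def papillonIso {r l : ℕ} (hr : 0 < r) (hl : 0 < l) :
    chainGraph (chainSize r l) ≃g papillonGraph r l where
  toEquiv := Equiv.ofBijective _ (toPapillon_bijective hr hl)
  map_rel_iff' := toPapillon_adj hr hl _ _

theorem even_chainSize_iff {r l : ℕ} (hr : 0 < r) (hl : 0 < l) :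
    (∀ κ, Even (chainSize r l κ + 1)) ↔ Even r ∧ Even l := by
  rw [Bool.forall_bool]
  simp only [chainSize, Bool.false_eq_true, if_false, if_true, Nat.even_iff]
  omega

end Isomorphism

end PapillonPMH

theorem mainTheorem3 (r l : ℕ) (hr : 0 < r) (hl : 0 < l) :
    IsPMH (papillonGraph r l) ↔ Even r ∧ Even l := by
  have : Nonempty (PapillonVertex r l) := ⟨Sum.inl ⟨0, by omega⟩⟩
  rw [PapillonPMH.isPMH_iff_isPMHMap,
    ← PapillonPMH.isPMHMap_congr (PapillonPMH.papillonIso hr hl),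
    PapillonPMH.chainGraph_isPMHMap_iff, PapillonPMH.even_chainSize_iff hr hl]
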